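/- Let $T>0$, let $(\Omega,\mathcal F,P)$ be a probability space, and let $\Lambda=(\Lambda_t)_{t\in[0,T]}$ be a real Lévy process with $\Lambda_0=0$ (càdlàg, continuous in probability, with independent and stationary increments) such that $\mathbb E[\Lambda_t^2]<\infty$ for all $t\in[0,T]$. The log-characteristic function of a real random variable $Y$ is the continuous function $\Psi_Y:\mathbb R\to\mathbb C$ with $\Psi_Y(0)=0$ and $\mathbb E[e^{iuY}]=e^{\Psi_Y(u)}$ for all $u\in\mathbb R$ (unique when it exists). Let $\gamma:[0,T]\to\mathbb R$ be a bounded Borel function. Write $X_t=\int_0^t\gamma_s\,d\Lambda_s$ for the Wiener integral, i.e. the random variable (unique up to almost sure equality) such that $\int_0^t g_k\,d\Lambda\to X_t$ in probability for every sequence of step functions $g_k=\sum_i c_i\mathbf 1_{(s_i,s_{i+1}]}$ on $[0,T]$ converging to $\gamma$ in $L^2([0,T],ds)$, where $\int_0^t g\,d\Lambda=\sum_i c_i(\Lambda_{t\wedge s_{i+1}}-\Lambda_{t\wedge s_i})$ for $g=\sum_i c_i\mathbf 1_{(s_i,s_{i+1}]}$. Then there is a unique function $\Psi_\Lambda:\mathbb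 R\to\mathbb C$ such that $\Psi_{\Lambda_t}(u)=t\,\Psi_\Lambda(u)$ for all $t\in[0,T]$ and $u\in\mathbb R$; the integrals $X_t$, $t\in[0,T]$, exist; and for every $t\in[0,T]$ the log-characteristic function of $X_t$ exists and is $$\Psi_{X_t}(u)=\int_0^t\Psi_\Lambda(u\gamma_s)\,ds,\qquad u\in\mathbb R,$$ so that $\mathbb E[\exp(iuX_t)]=\exp(\Psi_{X_t}(u))$, where $s\mapsto\Psi_\Lambda(u\gamma_s)$ is integrable on $[0,t]$. In particular, for every $t\in[0,T]$ the function $u\mapsto\Psi_{X_t}(u)$ is of class $C^2$ on $\mathbb R$, and $X_t$ is square integrable. -/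

import Mathlib

open MeasureTheory ProbabilityTheory Filter Topology

noncomputable section

/-- A path indexed by `[0,T]` is càdlàg: right-continuous at every point of `[0,T]`, with a finite
left limit there (at `0` the filter `𝓝[Set.Ico 0 0] 0` is trivial; at `T` the right-continuity
condition is trivial). -/
def IsCadlagOn (T : ℝ) (x : ℝ → ℝ) : Prop :=
  ∀ t ∈ Set.Icc 0 T, ContinuousWithinAt x (Set.Icc t T) t ∧
    ∃ l : ℝ, Tendsto x (𝓝[Set.Ico 0 t] t) (𝓝 l)

/-- `Λ = (Λ_t)_{t ∈ [0,T]}` is a real Lévy process on `[0,T]` with `Λ_0 = 0`.  The process is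
written as a family indexed by `ℝ`; only its values at times in `[0,T]` are constrained (and used). -/
structure IsLevyProcess {Ω : Type*} [MeasurableSpace Ω] (P : Measure Ω) (T : ℝ)
    (Λ : ℝ → Ω → ℝ) : Prop where
  /-- each `Λ_t` is a random variable -/
  measurable : ∀ t ∈ Set.Icc 0 T, Measurable (Λ t)
  /-- the process starts at zero -/
  zero : ∀ᵐ ω ∂P, Λ 0 ω = 0
  /-- the paths are càdlàg -/
  cadlag : ∀ᵐ ω ∂P, IsCadlagOn T (fun t => Λ t ω)
  /-- continuity in probability -/
  continuousInProbability : ∀ t ∈ Set.Icc 0 T, TendstoInMeasure P Λ (𝓝[Set.Icc 0 T] t) (Λ t)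
  /-- independent increments -/
  indep : HasIndepIncrements (fun t : Set.Icc (0 : ℝ) T => Λ t) P
  /-- stationary increments: the law of `Λ_t - Λ_s` is that of `Λ_{t-s}` -/
  stationary : ∀ s t : ℝ, 0 ≤ s → s ≤ t → t ≤ T →
    IdentDistrib (fun ω => Λ t ω - Λ s ω) (Λ (t - s)) P P

/-- `Ψ` is the log-characteristic function of the law `μ`: the continuous function with `Ψ(0) = 0`
and `∫ exp(iux) μ(dx) = exp(Ψ(u))` for all real `u`.  (Continuity makes it unique.) -/
def IsLogCharFun (μ : Measure ℝ) (Ψ : ℝ → ℂ) : Prop :=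
  Continuous Ψ ∧ Ψ 0 = 0 ∧ ∀ u : ℝ, charFun μ u = Complex.exp (Ψ u)

/-- `Ψ` is the function `Ψ_Λ` for which `(t,u) ↦ t Ψ_Λ(u)` is the log-characteristic function of
the process `Λ` on `[0,T]`. -/
def IsLevyExponent {Ω : Type*} [MeasurableSpace Ω] (P : Measure Ω) (T : ℝ)
    (Λ : ℝ → Ω → ℝ) (Ψ : ℝ → ℂ) : Prop :=
  ∀ t ∈ Set.Icc 0 T, IsLogCharFun (P.map (Λ t)) (fun u => (t : ℂ) * Ψ u)

/-- A step function `∑_{i<n} c_i 1_{(s_i, s_{i+1}]}` with nodes `s_0 ≤ s_1 ≤ …` in `[0,T]`. -/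
structure StepFunction (T : ℝ) where
  /-- the number of steps -/
  n : ℕ
  /-- the nodes -/
  node : ℕ → ℝ
  /-- the values -/
  val : ℕ → ℝ
  monotone_node : Monotone node
  node_mem : ∀ i, node i ∈ Set.Icc 0 T

/-- The underlying function of a step function. -/
def StepFunction.toFun {T : ℝ} (g : StepFunction T) (s : ℝ) : ℝ :=
  ∑ i ∈ Finset.range g.n, (Set.Ioc (g.node i) (g.node (i + 1))).indicator (fun _ => g.val i) s

/-- The elementary integral
`∫_0^t g dΛ = ∑_{i<n} c_i (Λ_{min(t, s_{i+1})} - Λ_{min(t, s_i)})`. -/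
def StepFunction.integral {Ω : Type*} {T : ℝ} (g : StepFunction T) (Λ : ℝ → Ω → ℝ) (t : ℝ)
    (ω : Ω) : ℝ :=
  ∑ i ∈ Finset.range g.n, g.val i * (Λ (min t (g.node (i + 1))) ω - Λ (min t (g.node i)) ω)

/-- `X_t = ∫_0^t γ_s dΛ_s` for every `t ∈ [0,T]` (Wiener integral of a deterministic function):
`X_t` is a random variable, and whenever step functions `g_k` converge to `γ` in `L²([0,T], ds)`,
the elementary integrals `∫_0^t g_k dΛ` converge to `X_t` in probability.  This determines
every `X_t` up to almost sure equality. -/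
def IsWienerIntegral {Ω : Type*} [MeasurableSpace Ω] (P : Measure Ω) (T : ℝ)
    (Λ : ℝ → Ω → ℝ) (γ : ℝ → ℝ) (X : ℝ → Ω → ℝ) : Prop :=
  ∀ t ∈ Set.Icc 0 T, AEMeasurable (X t) P ∧
    ∀ g : ℕ → StepFunction T,
      Tendsto (fun k => eLpNorm (fun s => (g k).toFun s - γ s) 2
        (volume.restrict (Set.Icc 0 T))) atTop (𝓝 0) →
      TendstoInMeasure P (fun k => (g k).integral Λ t) atTop (X t)

end

/-!
The characteristic functions `φ_t` of `Λ_t` satisfy `φ_{s+t} = φ_s φ_t`, and means and variances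
are additive in time. An additive function on `[0,T]` that tends to `0` at `0` is linear
(`eq_smul_of_additive_of_tendsto_zero`). Monotonicity gives this for the variance; Chebyshev's
inequality and continuity in probability then give it for the mean, so that `𝔼|Λ_t| → 0`. Hence
`φ_t → 1` and `φ_t' → 0` pointwise as `t → 0`, the `φ_t` have no zeros, and the additive function
`t ↦ φ_t' / φ_t` is linear too. The exponent is therefore the primitive of `φ_T' / (T φ_T)`
(`IsLevyProcess.exists_exponent`); as `φ_T` is `C²` by the second moment assumption, so is the
exponent. Uniqueness is that of continuous logarithms (`eq_of_exp_eq_exp`).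

With `m = 𝔼[Λ_T] / T` and `σ² = Var[Λ_T] / T`, one has `𝔼[Λ_s Λ_t] = σ² min s t + m² s t`. By
bilinearity the elementary integral of step functions is Lipschitz from `L²([0,T])` to `L²(P)`
(`eLpNorm_stepIntegral_sub_le`), without passing to common refinements of partitions. A bounded
measurable `γ` is an `L²` limit of uniformly bounded step functions
(`StepFunction.exists_tendsto_eLpNorm`), so completeness of `L²(P)` yields the Wiener integral,
which is square integrable and is almost surely equal to every other version.

For a step function the formula for the characteristic function is the product formula for
independent stationary increments (`charFun_stepIntegral`), and it passes to the limit by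
dominated convergence (`charFun_wienerIntegral`). Smoothness of `u ↦ ∫ Ψ(u γ_s) ds` is
differentiation under the integral sign (`contDiff_integral_smul_comp`).
-/

/-! ### Additive functions on an interval and continuous logarithms -/

lemma map_natCast_mul_of_additive {E : Type*} [NormedAddCommGroup E] [NormedSpace ℝ E]
    {T : ℝ} {f : ℝ → E} (hadd : ∀ s t, 0 ≤ s → 0 ≤ t → s + t ≤ T → f (s + t) = f s + f t)
    {h : ℝ} (hh : 0 ≤ h) (k : ℕ) (hk : k * h ≤ T) : f (k * h) = (k : ℝ) • f h := by
  induction k with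
  | zero =>
    have : f 0 = 0 := by simpa using hadd 0 0 le_rfl le_rfl (by simpa using hk)
    simp [this]
  | succ k ih =>
    push_cast at hk ⊢
    rw [add_mul, one_mul] at hk ⊢
    rw [hadd _ _ (by positivity) hh hk, ih (by linarith), add_smul, one_smul]

/-- A function that is additive on `[0,T]` and tends to `0` at `0` is linear there. -/
lemma eq_smul_of_additive_of_tendsto_zero {E : Type*} [NormedAddCommGroup E] [NormedSpace ℝ E]
    {T : ℝ} (hT : 0 < T) {f : ℝ → E}
    (hadd : ∀ s t, 0 ≤ s → 0 ≤ t → s + t ≤ T → f (s + t) = f s + f t)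
    (h0 : Tendsto f (𝓝[Set.Icc 0 T] 0) (𝓝 0)) {t : ℝ} (ht : t ∈ Set.Icc 0 T) :
    f t = (t / T) • f T := by
  have hmul : ∀ (h : ℝ), 0 ≤ h → ∀ k : ℕ, k * h ≤ T → f (k * h) = (k : ℝ) • f h :=
    fun h hh k => map_natCast_mul_of_additive hadd hh k
  have hstep : ∀ n : ℕ, 0 < n → f (T / n) = (1 / n : ℝ) • f T := by
    intro n hn
    have hn' : (n : ℝ) ≠ 0 := by positivity
    have := hmul (T / n) (by positivity) n (by field_simp; exact le_rfl)
    rw [mul_div_cancel₀ T hn'] at this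
    rw [this, smul_smul, one_div, inv_mul_cancel₀ hn', one_smul]
  -- compare `t` with the largest multiple of `T / n` below it
  set a := t / T with ha
  have ha0 : 0 ≤ a := div_nonneg ht.1 hT.le
  have hta : t = a * T := by rw [ha]; field_simp
  have hfl : Tendsto (fun n : ℕ => (⌊a * n⌋₊ : ℝ) / n) atTop (𝓝 a) :=
    (tendsto_nat_floor_mul_div_atTop ha0).comp tendsto_natCast_atTop_atTop
  have hrem : ∀ n : ℕ, 0 < n → 0 ≤ t - ⌊a * n⌋₊ * (T / n) := by
    intro n hn
    have hn' : (0 : ℝ) < n := by positivity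
    have h1 := Nat.floor_le (mul_nonneg ha0 hn'.le)
    have h2 : (⌊a * n⌋₊ : ℝ) * (T / n) ≤ a * n * (T / n) := by gcongr
    have h3 : a * n * (T / n) = t := by rw [hta]; field_simp
    linarith
  have heq : ∀ n : ℕ, 0 < n →
      f t = ((⌊a * n⌋₊ : ℝ) / n) • f T + f (t - ⌊a * n⌋₊ * (T / n)) := by
    intro n hn
    have h1 := hrem n hn
    have h2 := hadd (⌊a * n⌋₊ * (T / n)) (t - ⌊a * n⌋₊ * (T / n)) (by positivity) h1
      (by linarith [ht.2])
    rw [add_sub_cancel, hmul _ (by positivity) _ (by linarith [ht.2]), hstep n hn, smul_smul] at h2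
    rw [h2]; congr 2; ring
  have hlim : Tendsto (fun n : ℕ => t - ⌊a * n⌋₊ * (T / n)) atTop (𝓝[Set.Icc 0 T] 0) := by
    refine tendsto_nhdsWithin_iff.2 ⟨?_, ?_⟩
    · have : Tendsto (fun n : ℕ => t - (⌊a * n⌋₊ : ℝ) / n * T) atTop (𝓝 (t - a * T)) :=
        tendsto_const_nhds.sub (hfl.mul_const T)
      rw [← hta, sub_self] at this
      refine this.congr fun n => ?_
      ring
    · filter_upwards [eventually_gt_atTop 0] with n hn
      refine ⟨hrem n hn, ?_⟩
      have : (0 : ℝ) ≤ ⌊a * n⌋₊ * (T / n) := by positivity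
      linarith [ht.2]
  have h := (hfl.smul_const (f T)).add (h0.comp hlim)
  rw [add_zero] at h
  refine tendsto_nhds_unique (tendsto_const_nhds.congr' ?_) h
  filter_upwards [eventually_gt_atTop 0] with n hn
  exact heq n hn

/-- Two continuous logarithms of the same function that agree at `0` are equal. -/
lemma eq_of_exp_eq_exp {f g : ℝ → ℂ} (hf : Continuous f) (hg : Continuous g) (h0 : f 0 = g 0)
    (h : ∀ u, Complex.exp (f u) = Complex.exp (g u)) : f = g := by
  choose n hn using fun u => Complex.exp_eq_exp_iff_exists_int.1 (h u)
  have hcast : ∀ u, ((n u : ℤ) : ℝ) = ((f u - g u) / (2 * Real.pi * Complex.I)).re := by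
    intro u
    rw [hn u, add_sub_cancel_left, mul_div_cancel_right₀ _ Complex.two_pi_I_ne_zero,
      Complex.intCast_re]
  have hc : Continuous n := by
    rw [Int.isClosedEmbedding_coe_real.isInducing.continuous_iff]
    have : (Int.cast ∘ n : ℝ → ℝ) = fun u => ((f u - g u) / (2 * Real.pi * Complex.I)).re :=
      funext hcast
    rw [this]
    fun_prop
  have hz : n 0 = 0 := by
    have := hcast 0
    rw [h0] at this
    simpa using this
  funext u
  have hu : n u = 0 := (PreconnectedSpace.constant inferInstance hc).trans hz
  rw [hn u, hu]; simp

/-! ### Characteristic functions of random variables with moments -/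

section CharFun

variable {Ω : Type*} [MeasurableSpace Ω] {P : Measure Ω}

lemma charFun_map_apply {X : Ω → ℝ} (hX : AEMeasurable X P) (u : ℝ) :
    charFun (P.map X) u = ∫ ω, Complex.exp (u * X ω * Complex.I) ∂P := by
  rw [charFun_apply_real, integral_map hX (by fun_prop)]

lemma memLp_id_map {X : Ω → ℝ} {p : ENNReal} (hX : MemLp X p P) : MemLp id p (P.map X) :=
  (memLp_map_measure_iff (by fun_prop) hX.1.aemeasurable).2 hX

lemma norm_deriv_charFun_map_le [IsProbabilityMeasure P] {X : Ω → ℝ} (hX : MemLp X 1 P) (u : ℝ) :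
    ‖deriv (charFun (P.map X)) u‖ ≤ ∫ ω, |X ω| ∂P := by
  have := Measure.isProbabilityMeasure_map hX.1.aemeasurable
  rw [← iteratedDeriv_one, iteratedDeriv_charFun (by simpa using memLp_id_map hX),
    integral_map hX.1.aemeasurable (by fun_prop), norm_mul]
  simp only [pow_one, Complex.norm_I, one_mul]
  refine (norm_integral_le_integral_norm _).trans_eq (integral_congr_ae (ae_of_all _ fun ω => ?_))
  simp only [norm_mul, Complex.norm_real, Real.norm_eq_abs]
  rw [← Complex.ofReal_mul, Complex.norm_exp_ofReal_mul_I, mul_one]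

lemma norm_charFun_map_sub_one_le [IsProbabilityMeasure P] {X : Ω → ℝ} (hX : MemLp X 1 P) (u : ℝ) :
    ‖charFun (P.map X) u - 1‖ ≤ |u| * ∫ ω, |X ω| ∂P := by
  have hi : Integrable (fun ω => Complex.exp (u * X ω * Complex.I)) P := by
    refine Integrable.of_bound (C := 1) ?_ (ae_of_all _ fun ω => ?_)
    · have := hX.1.aemeasurable
      exact AEMeasurable.aestronglyMeasurable (by fun_prop)
    · rw [← Complex.ofReal_mul, Complex.norm_exp_ofReal_mul_I]
  rw [charFun_map_apply hX.1.aemeasurable, ← integral_const_mul]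
  have h1 : (1 : ℂ) = ∫ _, (1 : ℂ) ∂P := by simp
  rw [h1, ← integral_sub hi (integrable_const _)]
  refine (norm_integral_le_integral_norm _).trans ?_
  refine integral_mono (hi.sub (integrable_const _)).norm
    ((memLp_one_iff_integrable.1 hX).abs.const_mul _) fun ω => ?_
  have := Real.norm_exp_I_mul_ofReal_sub_one_le (x := u * X ω)
  rw [Real.norm_eq_abs, abs_mul] at this
  simpa [mul_comm Complex.I] using this

/-- The variance of `|X|` is nonnegative. -/
lemma sq_integral_abs_le [IsProbabilityMeasure P] {X : Ω → ℝ} (hX : MemLp X 2 P) :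
    (∫ ω, |X ω| ∂P) ^ 2 ≤ ∫ ω, X ω ^ 2 ∂P := by
  have h := variance_eq_sub (μ := P) (X := fun ω => |X ω|) hX.abs
  have h2 := variance_nonneg (fun ω => |X ω|) P
  simp only [Pi.pow_apply, sq_abs] at h
  linarith

end CharFun

/-! ### Moments of a square integrable Lévy process -/

section SquareIntegrable

variable {Ω : Type*} [MeasurableSpace Ω] {P : Measure Ω}

namespace IsLevyProcess

variable {T : ℝ} {Λ : ℝ → Ω → ℝ}

lemma indepFun_increment (h : IsLevyProcess P T Λ) {s t : ℝ} (hs : 0 ≤ s) (hst : s ≤ t)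
    (ht : t ≤ T) : IndepFun (Λ s) (fun ω => Λ t ω - Λ s ω) P :=
  h.indep.indepFun_eval_sub (r := ⟨0, le_rfl, hs.trans (hst.trans ht)⟩)
    (s := ⟨s, hs, hst.trans ht⟩) (t := ⟨t, hs.trans hst, ht⟩) hs hst h.zero

lemma charFun_add [IsProbabilityMeasure P] (h : IsLevyProcess P T Λ) {s t : ℝ} (hs : 0 ≤ s)
    (ht : 0 ≤ t) (hst : s + t ≤ T) :
    charFun (P.map (Λ (s + t))) = charFun (P.map (Λ s)) * charFun (P.map (Λ t)) := by
  have hm1 := h.measurable s ⟨hs, by linarith⟩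
  have hm2 := h.measurable (s + t) ⟨by linarith, hst⟩
  have hi : IndepFun (Λ s) (Λ (s + t) - Λ s) P :=
    h.indepFun_increment hs (le_add_of_nonneg_right ht) hst
  have key := hi.charFun_map_add_eq_mul hm1.aemeasurable (hm2.sub hm1).aemeasurable
  have hid := (h.stationary s (s + t) hs (by linarith) hst).map_eq
  rw [add_sub_cancel_left] at hid
  rwa [add_sub_cancel, show Λ (s + t) - Λ s = fun ω => Λ (s + t) ω - Λ s ω from rfl, hid] at key

lemma integral_add [IsProbabilityMeasure P] (h : IsLevyProcess P T Λ)
    (h2 : ∀ t ∈ Set.Icc 0 T, MemLp (Λ t) 2 P) {s t : ℝ} (hs : 0 ≤ s)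
    (ht : 0 ≤ t) (hst : s + t ≤ T) : P[Λ (s + t)] = P[Λ s] + P[Λ t] := by
  have i1 := (h2 s ⟨hs, by linarith⟩).integrable one_le_two
  have i2 := (h2 (s + t) ⟨by linarith, hst⟩).integrable one_le_two
  have hid := (h.stationary s (s + t) hs (by linarith) hst).integral_eq
  rw [add_sub_cancel_left, integral_sub i2 i1] at hid
  linarith

lemma variance_add [IsProbabilityMeasure P] (h : IsLevyProcess P T Λ)
    (h2 : ∀ t ∈ Set.Icc 0 T, MemLp (Λ t) 2 P) {s t : ℝ} (hs : 0 ≤ s)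
    (ht : 0 ≤ t) (hst : s + t ≤ T) : Var[Λ (s + t); P] = Var[Λ s; P] + Var[Λ t; P] := by
  have i1 := h2 s ⟨hs, by linarith⟩
  have i2 := h2 (s + t) ⟨by linarith, hst⟩
  have hi : IndepFun (Λ s) (Λ (s + t) - Λ s) P :=
    h.indepFun_increment hs (le_add_of_nonneg_right ht) hst
  have key := hi.variance_add i1 (i2.sub i1)
  have hid := (h.stationary s (s + t) hs (by linarith) hst).variance_eq
  rw [add_sub_cancel_left] at hid
  rwa [add_sub_cancel, show Λ (s + t) - Λ s = fun ω => Λ (s + t) ω - Λ s ω from rfl, hid] at key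

/-- The variance is additive and monotone in time, so that it is at most `Var[Λ_T] / n` on
`[0, T / n]`. -/
lemma tendsto_variance [IsProbabilityMeasure P] (h : IsLevyProcess P T Λ)
    (h2 : ∀ t ∈ Set.Icc 0 T, MemLp (Λ t) 2 P) (hT : 0 < T) :
    Tendsto (fun t => Var[Λ t; P]) (𝓝[Set.Icc 0 T] 0) (𝓝 0) := by
  have hmono : ∀ s t, 0 ≤ s → s ≤ t → t ≤ T → Var[Λ s; P] ≤ Var[Λ t; P] := by
    intro s t hs hst ht
    have := h.variance_add h2 hs (sub_nonneg.2 hst) (by linarith)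
    rw [add_sub_cancel] at this
    have := variance_nonneg (Λ (t - s)) P
    linarith
  have hlim : Tendsto (fun n : ℕ => Var[Λ T; P] / n) atTop (𝓝 0) :=
    tendsto_const_div_atTop_nhds_zero_nat _
  rw [Metric.tendsto_nhds]
  intro ε hε
  obtain ⟨n, hn, hn0⟩ := ((hlim.eventually (gt_mem_nhds hε)).and (eventually_gt_atTop 0)).exists
  have hn' : (0 : ℝ) < n := by positivity
  have hV : Var[Λ (T / n); P] = Var[Λ T; P] / n := by
    have := map_natCast_mul_of_additive (f := fun t => Var[Λ t; P])
      (fun s t => h.variance_add h2) (div_nonneg hT.le hn'.le) n (mul_div_cancel₀ _ hn'.ne').le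
    rw [mul_div_cancel₀ _ hn'.ne', smul_eq_mul] at this
    rw [this]; field_simp
  have hTn : T / n ≤ T := div_le_self hT.le (by exact_mod_cast hn0)
  have hTn0 : 0 < T / n := by positivity
  filter_upwards [self_mem_nhdsWithin, mem_nhdsWithin_of_mem_nhds (gt_mem_nhds hTn0)] with t ht1 ht2
  rw [Real.dist_eq, sub_zero, abs_of_nonneg (variance_nonneg _ _)]
  exact (hmono t (T / n) ht1.1 ht2.le hTn).trans_lt (hV ▸ hn)

/-- The means tend to `0`: `Λ_t` is small in probability, and by Chebyshev's inequality so is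
`Λ_t - 𝔼[Λ_t]`. -/
lemma tendsto_mean [IsProbabilityMeasure P] (h : IsLevyProcess P T Λ)
    (h2 : ∀ t ∈ Set.Icc 0 T, MemLp (Λ t) 2 P) (hT : 0 < T) :
    Tendsto (fun t => P[Λ t]) (𝓝[Set.Icc 0 T] 0) (𝓝 0) := by
  have hm : TendstoInMeasure P Λ (𝓝[Set.Icc 0 T] 0) (fun _ => (0 : ℝ)) :=
    (h.continuousInProbability 0 ⟨le_rfl, hT.le⟩).congr_right h.zero
  rw [tendstoInMeasure_iff_norm] at hm
  rw [Metric.tendsto_nhds]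
  intro ε hε
  have hε2 : 0 < ε / 2 := by positivity
  have hV : Tendsto (fun t => ENNReal.ofReal (Var[Λ t; P] / (ε / 2) ^ 2))
      (𝓝[Set.Icc 0 T] 0) (𝓝 0) := by
    have := ENNReal.tendsto_ofReal ((h.tendsto_variance h2 hT).div_const ((ε / 2) ^ 2))
    simpa using this
  have hsum := (hm (ε / 2) hε2).add hV
  rw [add_zero] at hsum
  filter_upwards [self_mem_nhdsWithin, hsum.eventually (gt_mem_nhds zero_lt_one)] with t ht hlt
  by_contra hge
  rw [Real.dist_eq, sub_zero, not_lt] at hge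
  -- if `|𝔼[Λ_t]| ≥ ε`, one of two events of small probability occurs at every `ω`
  have hcov : (Set.univ : Set Ω) ⊆ {ω | ε / 2 ≤ ‖Λ t ω - 0‖} ∪ {ω | ε / 2 ≤ |Λ t ω - P[Λ t]|} := by
    intro ω _
    by_contra hcon
    simp only [Set.mem_union, Set.mem_ofPred_eq, not_or, not_le, sub_zero, Real.norm_eq_abs] at hcon
    have := abs_sub_abs_le_abs_sub (P[Λ t]) (Λ t ω)
    rw [abs_sub_comm] at this
    linarith [hcon.1, hcon.2]
  have hc := meas_ge_le_variance_div_sq (h2 t ht) hε2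
  have := (measure_mono hcov).trans (measure_union_le (μ := P) _ _)
  rw [measure_univ] at this
  exact absurd (this.trans (add_le_add_right hc _)) (not_le.2 hlt)

lemma integral_eq [IsProbabilityMeasure P] (h : IsLevyProcess P T Λ)
    (h2 : ∀ t ∈ Set.Icc 0 T, MemLp (Λ t) 2 P) (hT : 0 < T) {t : ℝ} (ht : t ∈ Set.Icc 0 T) :
    P[Λ t] = P[Λ T] / T * t := by
  have := eq_smul_of_additive_of_tendsto_zero hT (f := fun t => P[Λ t])
    (fun s t => h.integral_add h2) (h.tendsto_mean h2 hT) ht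
  rw [this, smul_eq_mul]; ring

lemma variance_eq [IsProbabilityMeasure P] (h : IsLevyProcess P T Λ)
    (h2 : ∀ t ∈ Set.Icc 0 T, MemLp (Λ t) 2 P) (hT : 0 < T) {t : ℝ} (ht : t ∈ Set.Icc 0 T) :
    Var[Λ t; P] = Var[Λ T; P] / T * t := by
  have := eq_smul_of_additive_of_tendsto_zero hT (f := fun t => Var[Λ t; P])
    (fun s t => h.variance_add h2) (h.tendsto_variance h2 hT) ht
  rw [this, smul_eq_mul]; ring

lemma integral_sq_eq [IsProbabilityMeasure P] (h : IsLevyProcess P T Λ)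
    (h2 : ∀ t ∈ Set.Icc 0 T, MemLp (Λ t) 2 P) (hT : 0 < T) {t : ℝ} (ht : t ∈ Set.Icc 0 T) :
    ∫ ω, Λ t ω ^ 2 ∂P = Var[Λ T; P] / T * t + (P[Λ T] / T * t) ^ 2 := by
  have := variance_eq_sub (h2 t ht)
  simp only [Pi.pow_apply] at this
  rw [← h.integral_eq h2 hT ht, ← h.variance_eq h2 hT ht]
  linarith

/-- The mixed second moments, from the independence of `Λ_s` and `Λ_t - Λ_s` for `s ≤ t`. -/
lemma integral_mul_eq [IsProbabilityMeasure P] (h : IsLevyProcess P T Λ)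
    (h2 : ∀ t ∈ Set.Icc 0 T, MemLp (Λ t) 2 P) (hT : 0 < T) {s t : ℝ} (hs : s ∈ Set.Icc 0 T)
    (ht : t ∈ Set.Icc 0 T) :
    ∫ ω, Λ s ω * Λ t ω ∂P
      = Var[Λ T; P] / T * min s t + (P[Λ T] / T) ^ 2 * (s * t) := by
  wlog hst : s ≤ t generalizing s t
  · have := this ht hs (le_of_not_ge hst)
    rw [min_comm, mul_comm s t, ← this]
    exact integral_congr_ae (ae_of_all _ fun ω => mul_comm _ _)
  have hi := IndepFun.integral_mul_eq_mul_integral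
    (Y := Λ t - Λ s) (h.indepFun_increment hs.1 hst ht.2) (h2 s hs).1 ((h2 t ht).sub (h2 s hs)).1
  have e : (fun ω => Λ s ω * Λ t ω) = fun ω => (Λ s * (Λ t - Λ s)) ω + Λ s ω ^ 2 := by
    ext ω; simp only [Pi.mul_apply, Pi.sub_apply]; ring
  have i1 := (h2 s hs).integrable one_le_two
  have i2 := (h2 t ht).integrable one_le_two
  rw [e, _root_.MeasureTheory.integral_add ((h2 s hs).integrable_mul ((h2 t ht).sub (h2 s hs)))
      (h2 s hs).integrable_sq, hi, integral_sub' i2 i1, h.integral_sq_eq h2 hT hs,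
    h.integral_eq h2 hT hs, h.integral_eq h2 hT ht, min_eq_left hst]
  ring

lemma tendsto_integral_abs [IsProbabilityMeasure P] (h : IsLevyProcess P T Λ)
    (h2 : ∀ t ∈ Set.Icc 0 T, MemLp (Λ t) 2 P) (hT : 0 < T) :
    Tendsto (fun t => ∫ ω, |Λ t ω| ∂P) (𝓝[Set.Icc 0 T] 0) (𝓝 0) := by
  have hlim : Tendsto (fun t => √(Var[Λ T; P] / T * t + (P[Λ T] / T * t) ^ 2))
      (𝓝[Set.Icc 0 T] 0) (𝓝 0) := by
    have hc : Continuous fun t => √(Var[Λ T; P] / T * t + (P[Λ T] / T * t) ^ 2) := by fun_prop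
    simpa using (hc.tendsto 0).mono_left nhdsWithin_le_nhds
  refine tendsto_of_tendsto_of_tendsto_of_le_of_le' tendsto_const_nhds hlim ?_ ?_
  · exact Eventually.of_forall fun t => integral_nonneg fun ω => abs_nonneg _
  · filter_upwards [self_mem_nhdsWithin] with t ht
    rw [← h.integral_sq_eq h2 hT ht]
    exact Real.le_sqrt_of_sq_le (sq_integral_abs_le (h2 t ht))

lemma tendsto_charFun [IsProbabilityMeasure P] (h : IsLevyProcess P T Λ)
    (h2 : ∀ t ∈ Set.Icc 0 T, MemLp (Λ t) 2 P) (hT : 0 < T) (u : ℝ) :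
    Tendsto (fun t => charFun (P.map (Λ t)) u) (𝓝[Set.Icc 0 T] 0) (𝓝 1) := by
  rw [tendsto_iff_norm_sub_tendsto_zero]
  have := (h.tendsto_integral_abs h2 hT).const_mul |u|
  rw [mul_zero] at this
  refine tendsto_of_tendsto_of_tendsto_of_le_of_le' tendsto_const_nhds this
    (Eventually.of_forall fun t => norm_nonneg _) ?_
  filter_upwards [self_mem_nhdsWithin] with t ht
  exact norm_charFun_map_sub_one_le ((h2 t ht).mono_exponent one_le_two) u

/-! ### The exponent of a square integrable Lévy process -/

/-- The characteristic functions have no zeros: a zero of `φ_t = φ_{t/2} ^ 2` is one of `φ_{t/2}`,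
hence of every `φ_{t/2^n}`, while `φ_{t/2^n} → 1`. -/
lemma charFun_ne_zero [IsProbabilityMeasure P] (h : IsLevyProcess P T Λ)
    (h2 : ∀ t ∈ Set.Icc 0 T, MemLp (Λ t) 2 P) (hT : 0 < T) {t : ℝ} (ht : t ∈ Set.Icc 0 T)
    (u : ℝ) : charFun (P.map (Λ t)) u ≠ 0 := by
  intro h0
  have hmem : ∀ n : ℕ, t * (1 / 2) ^ n ∈ Set.Icc 0 T := fun n =>
    ⟨mul_nonneg ht.1 (by positivity),
      (mul_le_of_le_one_right ht.1 (pow_le_one₀ (by norm_num) (by norm_num))).trans ht.2⟩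
  have hz : ∀ n : ℕ, charFun (P.map (Λ (t * (1 / 2) ^ n))) u = 0 := by
    intro n
    induction n with
    | zero => simpa using h0
    | succ n ih =>
      have e : t * (1 / 2 : ℝ) ^ n = t * (1 / 2) ^ (n + 1) + t * (1 / 2) ^ (n + 1) := by ring
      rw [e, h.charFun_add (hmem _).1 (hmem _).1 (e ▸ (hmem n).2), Pi.mul_apply,
        mul_self_eq_zero] at ih
      exact ih
  have hlim : Tendsto (fun n : ℕ => t * (1 / 2 : ℝ) ^ n) atTop (𝓝[Set.Icc 0 T] 0) := by
    refine tendsto_nhdsWithin_iff.2 ⟨?_, Eventually.of_forall hmem⟩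
    simpa using (tendsto_pow_atTop_nhds_zero_of_lt_one (r := (1 / 2 : ℝ)) (by norm_num)
      (by norm_num)).const_mul t
  have := (h.tendsto_charFun h2 hT u).comp hlim
  exact zero_ne_one (tendsto_nhds_unique
    (tendsto_const_nhds.congr fun n => (hz n).symm) this)

lemma differentiable_charFun [IsProbabilityMeasure P]
    (h2 : ∀ t ∈ Set.Icc 0 T, MemLp (Λ t) 2 P) {t : ℝ} (ht : t ∈ Set.Icc 0 T) :
    Differentiable ℝ (charFun (P.map (Λ t))) := by
  have := Measure.isProbabilityMeasure_map (h2 t ht).1.aemeasurable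
  exact (contDiff_charFun (n := 2) (by exact_mod_cast memLp_id_map (h2 t ht))).differentiable
    (by norm_num)

/-- The logarithmic derivative of `φ_t` is linear in `t`. -/
lemma logDeriv_charFun [IsProbabilityMeasure P] (h : IsLevyProcess P T Λ)
    (h2 : ∀ t ∈ Set.Icc 0 T, MemLp (Λ t) 2 P) (hT : 0 < T) {t : ℝ} (ht : t ∈ Set.Icc 0 T)
    (u : ℝ) :
    logDeriv (charFun (P.map (Λ t))) u = (t / T) • logDeriv (charFun (P.map (Λ T))) u := by
  refine eq_smul_of_additive_of_tendsto_zero hT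
    (f := fun t => logDeriv (charFun (P.map (Λ t))) u) (fun s t hs ht hst => ?_) ?_ ht
  · have hs' : s ∈ Set.Icc 0 T := ⟨hs, by linarith⟩
    have ht' : t ∈ Set.Icc 0 T := ⟨ht, by linarith⟩
    rw [h.charFun_add hs ht hst]
    exact logDeriv_mul u (h.charFun_ne_zero h2 hT hs' u) (h.charFun_ne_zero h2 hT ht' u)
      (differentiable_charFun h2 hs' u) (differentiable_charFun h2 ht' u)
  · have hd : Tendsto (fun t => deriv (charFun (P.map (Λ t))) u) (𝓝[Set.Icc 0 T] 0) (𝓝 0) := by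
      refine squeeze_zero_norm' ?_ (h.tendsto_integral_abs h2 hT)
      filter_upwards [self_mem_nhdsWithin] with t ht
      exact norm_deriv_charFun_map_le ((h2 t ht).mono_exponent one_le_two) u
    have := hd.div (h.tendsto_charFun h2 hT u) one_ne_zero
    rwa [zero_div] at this

/-- The exponent of a square integrable Lévy process exists and is twice continuously
differentiable: it is the primitive of the logarithmic derivative of `φ_T`, divided by `T`. -/
theorem exists_exponent [IsProbabilityMeasure P] (h : IsLevyProcess P T Λ)
    (h2 : ∀ t ∈ Set.Icc 0 T, MemLp (Λ t) 2 P) (hT : 0 < T) :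
    ∃ Ψ : ℝ → ℂ, IsLevyExponent P T Λ Ψ ∧ ContDiff ℝ 2 Ψ := by
  have hTm : T ∈ Set.Icc 0 T := ⟨hT.le, le_rfl⟩
  have := Measure.isProbabilityMeasure_map (h2 T hTm).1.aemeasurable
  set L : ℝ → ℂ := fun u => (T : ℂ)⁻¹ * logDeriv (charFun (P.map (Λ T))) u with hL
  have hφ : ContDiff ℝ 2 (charFun (P.map (Λ T))) :=
    contDiff_charFun (n := 2) (by exact_mod_cast memLp_id_map (h2 T hTm))
  have hLc : ContDiff ℝ 1 L := by
    refine contDiff_const.mul ?_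
    simp only [logDeriv, div_eq_mul_inv]
    refine ContDiff.mul ?_ ((hφ.of_le one_le_two).inv (h.charFun_ne_zero h2 hT hTm))
    exact (contDiff_succ_iff_deriv (n := 1).1 (by simpa [one_add_one_eq_two] using hφ)).2.2
  set Ψ : ℝ → ℂ := fun u => ∫ v in (0 : ℝ)..u, L v with hΨ
  have hd : ∀ u, HasDerivAt Ψ (L u) u := fun u =>
    intervalIntegral.integral_hasDerivAt_right (hLc.continuous.intervalIntegrable _ _)
      hLc.continuous.stronglyMeasurable.stronglyMeasurableAtFilter hLc.continuous.continuousAt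
  have hΨ0 : Ψ 0 = 0 := by simp [hΨ]
  have hΨ2 : ContDiff ℝ 2 Ψ := by
    have : ContDiff ℝ (1 + 1) Ψ := contDiff_succ_iff_deriv.2
      ⟨fun u => (hd u).differentiableAt, by simp, by rwa [funext fun u => (hd u).deriv]⟩
    simpa [one_add_one_eq_two] using this
  refine ⟨Ψ, fun t ht => ⟨by have := hΨ2.continuous; fun_prop, by simp [hΨ0], fun u => ?_⟩, hΨ2⟩
  have := Measure.isProbabilityMeasure_map (h2 t ht).1.aemeasurable
  -- `φ_t exp (-t Ψ)` has derivative zero and the value `1` at `0`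
  have hder : ∀ v,
      HasDerivAt (fun v => charFun (P.map (Λ t)) v * Complex.exp (-(t * Ψ v))) 0 v := by
    intro v
    have h1 := (differentiable_charFun h2 ht v).hasDerivAt
    have h3 := (((hd v).const_mul (t : ℂ)).neg).cexp
    have h4 : deriv (charFun (P.map (Λ t))) v = charFun (P.map (Λ t)) v * (t * L v) := by
      have h5 := h.logDeriv_charFun h2 hT ht v
      rw [logDeriv_apply, div_eq_iff (h.charFun_ne_zero h2 hT ht v)] at h5
      rw [h5, hL, Complex.real_smul]
      push_cast
      ring
    refine (h1.mul h3).congr_deriv ?_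
    rw [h4]; ring
  have hconst := is_const_of_deriv_eq_zero (fun v => (hder v).differentiableAt)
    (fun v => (hder v).deriv) u 0
  simp only [hΨ0, charFun_zero, probReal_univ, mul_zero, neg_zero, Complex.exp_zero,
    Complex.ofReal_one, mul_one] at hconst
  rw [Complex.exp_neg, mul_inv_eq_one₀ (Complex.exp_ne_zero _)] at hconst
  exact hconst

end IsLevyProcess

lemma IsLevyExponent.unique {T : ℝ} {Λ : ℝ → Ω → ℝ} {Ψ Ψ' : ℝ → ℂ} (hT : 0 < T)
    (h : IsLevyExponent P T Λ Ψ) (h' : IsLevyExponent P T Λ Ψ') : Ψ = Ψ' := by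
  have hTm : T ∈ Set.Icc 0 T := ⟨hT.le, le_rfl⟩
  have := eq_of_exp_eq_exp (h T hTm).1 (h' T hTm).1 ((h T hTm).2.1.trans (h' T hTm).2.1.symm)
    fun u => ((h T hTm).2.2 u).symm.trans ((h' T hTm).2.2 u)
  funext u
  exact mul_left_cancel₀ (by exact_mod_cast hT.ne') (congrFun this u)

end SquareIntegrable

/-! ### Integrals of indicators of intervals -/

lemma intervalIntegral_indicator_Ioc_const {E : Type*} [NormedAddCommGroup E] [NormedSpace ℝ E]
    [CompleteSpace E] {t a b : ℝ} (ht : 0 ≤ t) (ha : 0 ≤ a) (hab : a ≤ b) (c : E) :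
    ∫ s in (0 : ℝ)..t, (Set.Ioc a b).indicator (fun _ => c) s = (min t b - min t a) • c := by
  rw [intervalIntegral.integral_of_le ht, integral_indicator measurableSet_Ioc,
    Measure.restrict_restrict measurableSet_Ioc, setIntegral_const, Set.Ioc_inter_Ioc,
    max_eq_left ha, Real.volume_real_Ioc, min_comm b t]
  congr 1
  rcases le_total a t with h | h
  · rw [min_eq_right h, max_eq_left (by rw [sub_nonneg]; exact le_min h hab)]
  · rw [min_eq_left h, min_eq_left (h.trans hab), sub_self, max_eq_right (by linarith)]

lemma intervalIntegrable_indicator_Ioc_const {E : Type*} [NormedAddCommGroup E]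
    (a b t : ℝ) (c : E) :
    IntervalIntegrable (fun s => (Set.Ioc a b).indicator (fun _ => c) s) volume 0 t := by
  rw [intervalIntegrable_iff]
  have : IsFiniteMeasure (volume.restrict (Set.uIoc 0 t)) := by
    unfold Set.uIoc; infer_instance
  exact (integrable_const c).indicator measurableSet_Ioc

lemma intervalIntegrable_indicator_mul_indicator (a b c d t x y : ℝ) :
    IntervalIntegrable (fun s => (Set.Ioc a b).indicator (fun _ => x) s
      * (Set.Ioc c d).indicator (fun _ => y) s) volume 0 t := by
  have e : (fun s => (Set.Ioc a b).indicator (fun _ => x) s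
      * (Set.Ioc c d).indicator (fun _ => y) s)
      = fun s => (Set.Ioc (max a c) (min b d)).indicator (fun _ => x * y) s := by
    ext s
    simp only [Set.indicator_apply, Set.mem_Ioc, max_lt_iff, le_min_iff]
    grind
  rw [e]
  exact intervalIntegrable_indicator_Ioc_const _ _ _ _

/-- The overlap of `(a,b]` and `(c,d]` on `[0,t]` is the second difference of the kernel
`min` at the truncated end points. -/
lemma intervalIntegral_indicator_mul_indicator {t a b c d : ℝ} (ht : 0 ≤ t) (ha : 0 ≤ a)
    (hab : a ≤ b) (hc : 0 ≤ c) (hcd : c ≤ d) (x y : ℝ) :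
    ∫ s in (0 : ℝ)..t,
        (Set.Ioc a b).indicator (fun _ => x) s * (Set.Ioc c d).indicator (fun _ => y) s
      = (min (min t b) (min t d) - min (min t b) (min t c) - min (min t a) (min t d)
        + min (min t a) (min t c)) * (x * y) := by
  have key : ∀ s, (Set.Ioc a b).indicator (fun _ => x) s * (Set.Ioc c d).indicator (fun _ => y) s
      = (Set.Ioc 0 (min b d)).indicator (fun _ => x * y) s
        - (Set.Ioc 0 (min b c)).indicator (fun _ => x * y) s
        - (Set.Ioc 0 (min a d)).indicator (fun _ => x * y) s
        + (Set.Ioc 0 (min a c)).indicator (fun _ => x * y) s := by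
    intro s
    simp only [Set.indicator_apply, Set.mem_Ioc, le_min_iff]
    grind
  have hb := ha.trans hab
  have hd := hc.trans hcd
  have I := fun r => intervalIntegrable_indicator_Ioc_const 0 r t (x * y)
  simp only [key]
  rw [intervalIntegral.integral_add ((((I _).sub (I _)).sub (I _))) (I _),
    intervalIntegral.integral_sub ((I _).sub (I _)) (I _),
    intervalIntegral.integral_sub (I _) (I _)]
  rw [intervalIntegral_indicator_Ioc_const ht le_rfl (le_min hb hd),
    intervalIntegral_indicator_Ioc_const ht le_rfl (le_min hb hc),
    intervalIntegral_indicator_Ioc_const ht le_rfl (le_min ha hd),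
    intervalIntegral_indicator_Ioc_const ht le_rfl (le_min ha hc)]
  simp only [min_eq_right ht, sub_zero, smul_eq_mul, inf_inf_distrib_left t]
  ring

lemma sq_intervalIntegral_le {h : ℝ → ℝ} {t : ℝ} (ht : 0 ≤ t)
    (h1 : IntervalIntegrable h volume 0 t) (h2 : IntervalIntegrable (fun s => h s ^ 2) volume 0 t) :
    (∫ s in (0 : ℝ)..t, h s) ^ 2 ≤ t * ∫ s in (0 : ℝ)..t, h s ^ 2 := by
  rcases ht.eq_or_lt with rfl | ht'
  · simp
  set A := ∫ s in (0 : ℝ)..t, h s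
  -- the mean square deviation of `h` from its average `A / t` is nonnegative
  have h0 : 0 ≤ ∫ s in (0 : ℝ)..t, (h s - A / t) ^ 2 :=
    intervalIntegral.integral_nonneg ht fun s _ => sq_nonneg _
  have e : ∀ s, (h s - A / t) ^ 2 = h s ^ 2 - 2 * (A / t) * h s + (A / t) ^ 2 := fun s => by ring
  simp only [e] at h0
  rw [intervalIntegral.integral_add (h2.sub (h1.const_mul _)) intervalIntegrable_const,
    intervalIntegral.integral_sub h2 (h1.const_mul _), intervalIntegral.integral_const_mul,
    intervalIntegral.integral_const, smul_eq_mul, sub_zero] at h0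
  have := mul_nonneg ht h0
  have e2 : t * ((∫ s in (0 : ℝ)..t, h s ^ 2) - 2 * (A / t) * A + t * (A / t) ^ 2)
      = t * (∫ s in (0 : ℝ)..t, h s ^ 2) - A ^ 2 := by field_simp; ring
  linarith

/-! ### Step functions -/

namespace StepFunction

variable {T : ℝ}

lemma measurable_toFun (g : StepFunction T) : Measurable g.toFun := by
  unfold toFun
  exact Finset.measurable_sum _ fun i _ => measurable_const.indicator measurableSet_Ioc

lemma sum_indicator_of_mem {E : Type*} [AddCommMonoid E] (g : StepFunction T) (w : ℕ → E) {i : ℕ}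
    (hi : i ∈ Finset.range g.n) {s : ℝ} (hs : s ∈ Set.Ioc (g.node i) (g.node (i + 1))) :
    ∑ j ∈ Finset.range g.n, (Set.Ioc (g.node j) (g.node (j + 1))).indicator (fun _ => w j) s
      = w i := by
  have hne : ∀ j, j ≠ i → s ∉ Set.Ioc (g.node j) (g.node (j + 1)) := fun j hj hsj =>
    Set.disjoint_left.1 (g.monotone_node.pairwise_disjoint_on_Ioc_succ hj) hsj hs
  rw [Finset.sum_eq_single_of_mem i hi fun j _ hj => Set.indicator_of_notMem (hne j hj) _,
    Set.indicator_of_mem hs]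

lemma sum_indicator_of_forall_notMem {E : Type*} [AddCommMonoid E] (g : StepFunction T)
    (w : ℕ → E) {s : ℝ}
    (hs : ∀ i ∈ Finset.range g.n, s ∉ Set.Ioc (g.node i) (g.node (i + 1))) :
    ∑ j ∈ Finset.range g.n, (Set.Ioc (g.node j) (g.node (j + 1))).indicator (fun _ => w j) s
      = 0 :=
  Finset.sum_eq_zero fun i hi => Set.indicator_of_notMem (hs i hi) _

/-- The intervals of a step function are disjoint, so that `F ∘ g` is again a step function
whenever `F 0 = 0`. -/
lemma map_toFun {E : Type*} [AddCommMonoid E] (g : StepFunction T) {F : ℝ → E}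
    (hF : F 0 = 0) (s : ℝ) :
    F (g.toFun s) = ∑ i ∈ Finset.range g.n,
      (Set.Ioc (g.node i) (g.node (i + 1))).indicator (fun _ => F (g.val i)) s := by
  unfold toFun
  by_cases h : ∃ i ∈ Finset.range g.n, s ∈ Set.Ioc (g.node i) (g.node (i + 1))
  · obtain ⟨i, hi, hs⟩ := h
    rw [g.sum_indicator_of_mem _ hi hs, g.sum_indicator_of_mem (fun i => F (g.val i)) hi hs]
  · push Not at h
    rw [g.sum_indicator_of_forall_notMem _ h,
      g.sum_indicator_of_forall_notMem (fun i => F (g.val i)) h, hF]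

lemma memLp_toFun (g : StepFunction T) (p : ENNReal) (μ : Measure ℝ) [IsFiniteMeasure μ] :
    MemLp g.toFun p μ := by
  unfold toFun
  exact memLp_finsetSum _ fun i _ => (memLp_const _).indicator measurableSet_Ioc

lemma intervalIntegral_map_toFun {E : Type*} [NormedAddCommGroup E] [NormedSpace ℝ E]
    [CompleteSpace E] (g : StepFunction T) {F : ℝ → E} (hF : F 0 = 0) {t : ℝ} (ht : 0 ≤ t) :
    ∫ s in (0 : ℝ)..t, F (g.toFun s) = ∑ i ∈ Finset.range g.n,
      (min t (g.node (i + 1)) - min t (g.node i)) • F (g.val i) := by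
  simp only [g.map_toFun hF]
  rw [intervalIntegral.integral_finsetSum fun i _ =>
    intervalIntegrable_indicator_Ioc_const _ _ _ _]
  exact Finset.sum_congr rfl fun i _ => intervalIntegral_indicator_Ioc_const ht (g.node_mem i).1
    (g.monotone_node i.le_succ) _

lemma min_node_mem (g : StepFunction T) {t : ℝ} (ht : t ∈ Set.Icc 0 T) (i : ℕ) :
    min t (g.node i) ∈ Set.Icc 0 T :=
  ⟨le_min ht.1 (g.node_mem i).1, (min_le_left _ _).trans ht.2⟩

end StepFunction

/-! ### Elementary integrals against a Lévy process -/

section Levy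

open StepFunction

variable {Ω : Type*} [MeasurableSpace Ω] {P : Measure Ω} {T : ℝ} {Λ : ℝ → Ω → ℝ}

lemma memLp_stepIntegral (h2 : ∀ t ∈ Set.Icc 0 T, MemLp (Λ t) 2 P) (g : StepFunction T) {t : ℝ}
    (ht : t ∈ Set.Icc 0 T) : MemLp (g.integral Λ t) 2 P := by
  unfold StepFunction.integral
  exact memLp_finsetSum _ fun i _ =>
    ((h2 _ (g.min_node_mem ht _)).sub (h2 _ (g.min_node_mem ht _))).const_mul _

/-- For a step function, the formula for the characteristic function of the integral is the
product formula for the independent and stationary increments. -/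
lemma charFun_stepIntegral [IsProbabilityMeasure P] (h : IsLevyProcess P T Λ) {Ψ : ℝ → ℂ}
    (hΨ : IsLevyExponent P T Λ Ψ) (hΨ0 : Ψ 0 = 0) (g : StepFunction T) {t : ℝ}
    (ht : t ∈ Set.Icc 0 T) (u : ℝ) :
    charFun (P.map (g.integral Λ t)) u
      = Complex.exp (∫ s in (0 : ℝ)..t, Ψ (u * g.toFun s)) := by
  have hmono : Monotone fun i => (⟨min t (g.node i), g.min_node_mem ht i⟩ : Set.Icc (0 : ℝ) T) :=
    fun i j hij => Subtype.mk_le_mk.2 (min_le_min_left t (g.monotone_node hij))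
  have hm : ∀ i, Measurable (Λ (min t (g.node i))) := fun i => h.measurable _ (g.min_node_mem ht i)
  have hind : iIndepFun
      (fun i ω => g.val i * (Λ (min t (g.node (i + 1))) ω - Λ (min t (g.node i)) ω)) P :=
    (h.indep.nat hmono).comp (fun i x => g.val i * x) fun i => measurable_const_mul _
  have hprod := iIndepFun.charFun_map_fun_finsetSum_eq_prod (s := Finset.range g.n)
    (X := fun i ω => g.val i * (Λ (min t (g.node (i + 1))) ω - Λ (min t (g.node i)) ω))
    (fun i _ => (((hm (i + 1)).sub (hm i)).const_mul _).aemeasurable)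
    (hind.precomp (g := ((↑) : Finset.range g.n → ℕ)) Subtype.val_injective)
  have e : g.integral Λ t = fun ω => ∑ i ∈ Finset.range g.n,
      g.val i * (Λ (min t (g.node (i + 1))) ω - Λ (min t (g.node i)) ω) := rfl
  rw [e, hprod, Finset.prod_apply, g.intervalIntegral_map_toFun (F := fun x => Ψ (u * x))
    (by simpa using hΨ0) ht.1, Complex.exp_sum]
  refine Finset.prod_congr rfl fun i _ => ?_
  have hle : min t (g.node i) ≤ min t (g.node (i + 1)) :=
    min_le_min_left t (g.monotone_node i.le_succ)
  have hmap : P.map (fun ω => g.val i * (Λ (min t (g.node (i + 1))) ω - Λ (min t (g.node i)) ω))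
      = (P.map (Λ (min t (g.node (i + 1)) - min t (g.node i)))).map (fun x => g.val i * x) := by
    rw [← (h.stationary _ _ (g.min_node_mem ht i).1 hle (g.min_node_mem ht (i + 1)).2).map_eq,
      Measure.map_map (measurable_const_mul _) ((hm _).fun_sub (hm _))]
    rfl
  rw [hmap, charFun_map_mul, (hΨ _ ⟨sub_nonneg.2 hle, ?_⟩).2.2, Complex.real_smul,
    mul_comm u]
  linarith [(g.min_node_mem ht i).1, (g.min_node_mem ht (i + 1)).2]

/-- The mixed second moment of two elementary integrals. -/
lemma integral_stepIntegral_mul [IsProbabilityMeasure P] (h : IsLevyProcess P T Λ)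
    (h2 : ∀ t ∈ Set.Icc 0 T, MemLp (Λ t) 2 P) (hT : 0 < T) (g g' : StepFunction T) {t : ℝ}
    (ht : t ∈ Set.Icc 0 T) :
    ∫ ω, g.integral Λ t ω * g'.integral Λ t ω ∂P
      = Var[Λ T; P] / T * (∫ s in (0 : ℝ)..t, g.toFun s * g'.toFun s)
        + (P[Λ T] / T) ^ 2 * ((∫ s in (0 : ℝ)..t, g.toFun s) * ∫ s in (0 : ℝ)..t, g'.toFun s) := by
  have hL : ∀ (f : StepFunction T) i, MemLp (Λ (min t (f.node i))) 2 P := fun f i =>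
    h2 _ (f.min_node_mem ht i)
  have hD : ∀ (f : StepFunction T) i, MemLp
      (fun ω => f.val i * (Λ (min t (f.node (i + 1))) ω - Λ (min t (f.node i)) ω)) 2 P :=
    fun f i => ((hL f _).sub (hL f _)).const_mul _
  have hDD : ∀ i j, Integrable
      (fun ω => g.val i * (Λ (min t (g.node (i + 1))) ω - Λ (min t (g.node i)) ω)
        * (g'.val j * (Λ (min t (g'.node (j + 1))) ω - Λ (min t (g'.node j)) ω))) P :=
    fun i j => (hD g i).integrable_mul (hD g' j)
  have I : ∀ i j, Integrable
      (fun ω => Λ (min t (g.node i)) ω * Λ (min t (g'.node j)) ω) P :=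
    fun i j => (hL g i).integrable_mul (hL g' j)
  rw [g.intervalIntegral_map_toFun (F := fun x => x) rfl ht.1,
    g'.intervalIntegral_map_toFun (F := fun x => x) rfl ht.1]
  unfold StepFunction.integral StepFunction.toFun
  simp only [Finset.sum_mul_sum]
  rw [integral_finsetSum _ fun i _ => integrable_finsetSum _ fun j _ => hDD i j,
    intervalIntegral.integral_finsetSum, Finset.mul_sum, Finset.mul_sum,
    ← Finset.sum_add_distrib]
  · refine Finset.sum_congr rfl fun i _ => ?_
    rw [integral_finsetSum _ fun j _ => hDD i j,
      intervalIntegral.integral_finsetSum, Finset.mul_sum, Finset.mul_sum,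
      ← Finset.sum_add_distrib]
    · refine Finset.sum_congr rfl fun j _ => ?_
      have e : ∀ ω, g.val i * (Λ (min t (g.node (i + 1))) ω - Λ (min t (g.node i)) ω)
          * (g'.val j * (Λ (min t (g'.node (j + 1))) ω - Λ (min t (g'.node j)) ω))
          = g.val i * g'.val j * (
            Λ (min t (g.node (i + 1))) ω * Λ (min t (g'.node (j + 1))) ω
            - Λ (min t (g.node (i + 1))) ω * Λ (min t (g'.node j)) ω
            - Λ (min t (g.node i)) ω * Λ (min t (g'.node (j + 1))) ω
            + Λ (min t (g.node i)) ω * Λ (min t (g'.node j)) ω) := fun ω => by ring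
      have E := fun i j => h.integral_mul_eq h2 hT (g.min_node_mem ht i) (g'.min_node_mem ht j)
      simp only [e]
      rw [integral_const_mul, integral_add (((I _ _).sub' (I _ _)).sub' (I _ _)) (I _ _),
        integral_sub ((I _ _).sub' (I _ _)) (I _ _), integral_sub (I _ _) (I _ _),
        E, E, E, E, intervalIntegral_indicator_mul_indicator ht.1 (g.node_mem i).1
          (g.monotone_node i.le_succ) (g'.node_mem j).1 (g'.monotone_node j.le_succ)]
      simp only [smul_eq_mul]
      ring
    · exact fun j _ => intervalIntegrable_indicator_mul_indicator _ _ _ _ _ _ _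
  · have := fun i => IntervalIntegrable.sum (Finset.range g'.n) fun j _ =>
      intervalIntegrable_indicator_mul_indicator (g.node i) (g.node (i + 1)) (g'.node j)
        (g'.node (j + 1)) t (g.val i) (g'.val j)
    intro i _
    refine (this i).congr fun s _ => ?_
    simp

/-- The isometry for two step functions: with `m = 𝔼[Λ_T] / T` and `σ² = Var[Λ_T] / T`, the mean
square distance of the integrals is `σ² ∫ (g - g')² + m² (∫ (g - g'))²`. -/
lemma integral_sq_stepIntegral_sub [IsProbabilityMeasure P] (h : IsLevyProcess P T Λ)
    (h2 : ∀ t ∈ Set.Icc 0 T, MemLp (Λ t) 2 P) (hT : 0 < T) (g g' : StepFunction T) {t : ℝ}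
    (ht : t ∈ Set.Icc 0 T) :
    ∫ ω, (g.integral Λ t ω - g'.integral Λ t ω) ^ 2 ∂P
      = Var[Λ T; P] / T * (∫ s in (0 : ℝ)..t, (g.toFun s - g'.toFun s) ^ 2)
        + (P[Λ T] / T) ^ 2 * (∫ s in (0 : ℝ)..t, (g.toFun s - g'.toFun s)) ^ 2 := by
  have M := fun f : StepFunction T => memLp_stepIntegral h2 f ht
  have J : ∀ f f' : StepFunction T, Integrable
      (fun ω => f.integral Λ t ω * f'.integral Λ t ω) P := fun f f' => (M f).integrable_mul (M f')
  have N : ∀ f f' : StepFunction T,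
      IntervalIntegrable (fun s => f.toFun s * f'.toFun s) volume 0 t := fun f f' =>
    (intervalIntegrable_iff_integrableOn_Ioc_of_le ht.1).2
      ((f.memLp_toFun 2 _).integrable_mul (f'.memLp_toFun 2 _))
  have N1 : ∀ f : StepFunction T, IntervalIntegrable f.toFun volume 0 t := fun f =>
    (intervalIntegrable_iff_integrableOn_Ioc_of_le ht.1).2
      ((f.memLp_toFun 2 _).integrable one_le_two)
  have e : ∀ x y : ℝ, (x - y) ^ 2 = x * x - 2 * (x * y) + y * y := fun x y => by ring
  simp only [e (g.integral Λ t _), e (g.toFun _)]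
  rw [integral_add ((J g g).sub' ((J g g').const_mul 2)) (J g' g'),
    integral_sub (J g g) ((J g g').const_mul 2), integral_const_mul,
    intervalIntegral.integral_add ((N g g).sub ((N g g').const_mul 2)) (N g' g'),
    intervalIntegral.integral_sub (N g g) ((N g g').const_mul 2),
    intervalIntegral.integral_const_mul, intervalIntegral.integral_sub (N1 g) (N1 g')]
  simp only [integral_stepIntegral_mul h h2 hT _ _ ht]
  ring

lemma eLpNorm_two_eq_sqrt {α : Type*} [MeasurableSpace α] {μ : Measure α} {f : α → ℝ}
    (hf : MemLp f 2 μ) : eLpNorm f 2 μ = ENNReal.ofReal √(∫ x, f x ^ 2 ∂μ) := by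
  rw [hf.eLpNorm_eq_integral_rpow_norm two_ne_zero ENNReal.ofNat_ne_top, Real.sqrt_eq_rpow]
  simp

/-- The elementary integral is Lipschitz from `L²([0,T])` to `L²(P)`. -/
lemma eLpNorm_stepIntegral_sub_le [IsProbabilityMeasure P] (h : IsLevyProcess P T Λ)
    (h2 : ∀ t ∈ Set.Icc 0 T, MemLp (Λ t) 2 P) (hT : 0 < T) (g g' : StepFunction T) {t : ℝ}
    (ht : t ∈ Set.Icc 0 T) :
    eLpNorm (g.integral Λ t - g'.integral Λ t) 2 P
      ≤ ENNReal.ofReal √(Var[Λ T; P] / T + (P[Λ T] / T) ^ 2 * T)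
        * eLpNorm (g.toFun - g'.toFun) 2 (volume.restrict (Set.Icc 0 T)) := by
  have hσ : 0 ≤ Var[Λ T; P] / T := div_nonneg (variance_nonneg _ _) hT.le
  have hg : MemLp (g.toFun - g'.toFun) 2 (volume.restrict (Set.Icc 0 T)) :=
    (g.memLp_toFun _ _).sub (g'.memLp_toFun _ _)
  have hgt : MemLp (g.toFun - g'.toFun) 2 (volume.restrict (Set.Ioc 0 t)) :=
    (g.memLp_toFun _ _).sub (g'.memLp_toFun _ _)
  rw [eLpNorm_two_eq_sqrt ((memLp_stepIntegral h2 g ht).sub (memLp_stepIntegral h2 g' ht)),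
    eLpNorm_two_eq_sqrt hg, ← ENNReal.ofReal_mul (Real.sqrt_nonneg _),
    ← Real.sqrt_mul (by positivity)]
  refine ENNReal.ofReal_le_ofReal (Real.sqrt_le_sqrt ?_)
  simp only [Pi.sub_apply]
  rw [integral_sq_stepIntegral_sub h h2 hT g g' ht]
  have h1 : ∫ s in (0 : ℝ)..t, (g.toFun s - g'.toFun s) ^ 2
      ≤ ∫ s in Set.Icc 0 T, (g.toFun s - g'.toFun s) ^ 2 := by
    rw [intervalIntegral.integral_of_le ht.1]
    exact setIntegral_mono_set hg.integrable_sq (ae_of_all _ fun s => sq_nonneg _)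
      (Set.Ioc_subset_Icc_self.trans (Set.Icc_subset_Icc_right ht.2)).eventuallyLE
  have h3 := sq_intervalIntegral_le ht.1 (h := g.toFun - g'.toFun)
    ((intervalIntegrable_iff_integrableOn_Ioc_of_le ht.1).2 (hgt.integrable one_le_two))
    ((intervalIntegrable_iff_integrableOn_Ioc_of_le ht.1).2 hgt.integrable_sq)
  simp only [Pi.sub_apply] at h3
  have h4 : t * ∫ s in (0 : ℝ)..t, (g.toFun s - g'.toFun s) ^ 2
      ≤ T * ∫ s in Set.Icc 0 T, (g.toFun s - g'.toFun s) ^ 2 :=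
    mul_le_mul ht.2 h1 (intervalIntegral.integral_nonneg ht.1 fun s _ => sq_nonneg _) hT.le
  rw [add_mul, mul_assoc (_ ^ 2)]
  gcongr
  exact h3.trans h4

end Levy

/-! ### Approximation by step functions -/

namespace StepFunction

variable {T : ℝ}

lemma abs_toFun_le (g : StepFunction T) {C : ℝ} (hC : 0 ≤ C) (h : ∀ i, |g.val i| ≤ C) (s : ℝ) :
    |g.toFun s| ≤ C := by
  unfold toFun
  by_cases hs : ∃ i ∈ Finset.range g.n, s ∈ Set.Ioc (g.node i) (g.node (i + 1))
  · obtain ⟨i, hi, hs⟩ := hs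
    rw [g.sum_indicator_of_mem _ hi hs]
    exact h i
  · push Not at hs
    rwa [g.sum_indicator_of_forall_notMem _ hs, abs_zero]

/-- The step function sampling `f` at the left end points of the uniform partition of `[0,T]` into
`n` intervals. -/
noncomputable def sample (hT : 0 ≤ T) (f : ℝ → ℝ) (n : ℕ) : StepFunction T where
  n := n
  node i := min (i * (T / n)) T
  val i := f (min (i * (T / n)) T)
  monotone_node i j hij := by
    have : (0 : ℝ) ≤ T / n := by positivity
    dsimp only
    gcongr
  node_mem i := ⟨le_min (by positivity) hT, min_le_right _ _⟩

lemma abs_sample_sub_le (hT : 0 ≤ T) {f : ℝ → ℝ} {ε δ : ℝ}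
    (hf : ∀ x ∈ Set.Icc 0 T, ∀ y ∈ Set.Icc 0 T, |x - y| < δ → |f x - f y| ≤ ε) {n : ℕ} (hn : 0 < n)
    (hδ : T / n < δ) {s : ℝ} (hs : s ∈ Set.Ioc 0 T) : |(sample hT f n).toFun s - f s| ≤ ε := by
  classical
  set g := sample hT f n with hg
  have hn' : (n : ℝ) ≠ 0 := by positivity
  have hend : s ≤ g.node n := by
    have : g.node n = T := by simp [hg, sample, mul_div_cancel₀ T hn']
    rw [this]; exact hs.2
  -- the first node that is at least `s` closes the interval of the partition containing `s`
  have hex : ∃ j, s ≤ g.node j := ⟨n, hend⟩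
  have h0 : Nat.find hex ≠ 0 := by
    intro h0
    have := Nat.find_spec hex
    rw [h0] at this
    have h00 : g.node 0 = 0 := by simp [hg, sample, hT]
    linarith [hs.1]
  obtain ⟨i, hi⟩ := Nat.exists_eq_succ_of_ne_zero h0
  have hin : i < n := by
    have := Nat.find_min' hex hend
    omega
  have hle : s ≤ g.node (i + 1) := by
    have := Nat.find_spec hex
    rwa [hi] at this
  have hlt : g.node i < s := not_le.1 (Nat.find_min hex (by omega))
  rw [toFun, g.sum_indicator_of_mem _ (Finset.mem_range.2 hin) ⟨hlt, hle⟩]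
  refine hf _ (g.node_mem i) s ⟨hs.1.le, hs.2⟩ ?_
  have hstep : g.node (i + 1) ≤ g.node i + T / n := by
    have : (0 : ℝ) ≤ T / n := by positivity
    simp only [hg, sample]
    push_cast
    rw [← min_add_add_right]
    exact min_le_min (by linarith) (by linarith)
  rw [abs_sub_comm, abs_of_pos (by linarith)]
  linarith

/-- A bounded measurable function is an `L²` limit of step functions with a common bound:
approximate it by a continuous function, truncate that function, and sample it. -/
theorem exists_tendsto_eLpNorm (hT : 0 < T) {γ : ℝ → ℝ} (hγ : Measurable γ) {C : ℝ}
    (hC : ∀ s ∈ Set.Icc 0 T, |γ s| ≤ C) :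
    ∃ g : ℕ → StepFunction T, (∀ k s, |(g k).toFun s| ≤ C) ∧
      Tendsto (fun k => eLpNorm (fun s => (g k).toFun s - γ s) 2
        (volume.restrict (Set.Icc 0 T))) atTop (𝓝 0) := by
  have hC0 : 0 ≤ C := (abs_nonneg _).trans (hC 0 ⟨le_rfl, hT.le⟩)
  set μ : Measure ℝ := volume.restrict (Set.Icc 0 T) with hμ
  have hγC : ∀ᵐ s ∂μ, |γ s| ≤ C := (ae_restrict_iff' measurableSet_Icc).2 (ae_of_all _ hC)
  have hγ2 : MemLp γ 2 μ := MemLp.of_bound hγ.aestronglyMeasurable C hγC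
  have key : ∀ k : ℕ, ∃ g : StepFunction T, (∀ s, |g.toFun s| ≤ C) ∧
      eLpNorm (fun s => g.toFun s - γ s) 2 μ
        ≤ ENNReal.ofReal (1 / (k + 1)) + μ Set.univ ^ (2 : ENNReal).toReal⁻¹
          * ENNReal.ofReal (1 / (k + 1)) := by
    intro k
    have hε : (0 : ℝ) < 1 / (k + 1) := by positivity
    obtain ⟨f, hf, -⟩ := hγ2.exists_boundedContinuous_eLpNorm_sub_le (by norm_num)
      (ENNReal.ofReal_pos.2 hε).ne'
    set F : ℝ → ℝ := fun s => max (-C) (min C (f s)) with hF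
    have hFc : Continuous F := by fun_prop
    have hFC : ∀ s, |F s| ≤ C := fun s =>
      abs_le.2 ⟨le_max_left _ _, max_le (by linarith) (min_le_left _ _)⟩
    obtain ⟨δ, hδ, hδF⟩ := Metric.uniformContinuousOn_iff_le.1
      (isCompact_Icc.uniformContinuousOn_of_continuous (hFc.continuousOn (s := Set.Icc 0 T))) _ hε
    obtain ⟨n, hn, hn0⟩ := (((tendsto_const_div_atTop_nhds_zero_nat T).eventually
      (gt_mem_nhds hδ)).and (eventually_gt_atTop 0)).exists
    refine ⟨sample hT.le F n, abs_toFun_le _ hC0 fun i => hFC _, ?_⟩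
    have h1 : eLpNorm (F - γ) 2 μ ≤ ENNReal.ofReal (1 / (k + 1)) := by
      refine le_trans (eLpNorm_mono_ae ?_) hf
      filter_upwards [hγC] with s hs
      simp only [Pi.sub_apply, Real.norm_eq_abs, hF]
      rw [abs_le] at hs
      grind
    have h2 : eLpNorm ((sample hT.le F n).toFun - F) 2 μ
        ≤ μ Set.univ ^ (2 : ENNReal).toReal⁻¹ * ENNReal.ofReal (1 / (k + 1)) := by
      refine eLpNorm_le_of_ae_bound ?_
      have : ∀ᵐ s ∂volume.restrict (Set.Ioc 0 T),
          ‖((sample hT.le F n).toFun - F) s‖ ≤ 1 / (k + 1) :=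
        (ae_restrict_iff' measurableSet_Ioc).2 (ae_of_all _ fun s hs =>
          abs_sample_sub_le hT.le (fun x hx y hy hxy => hδF x hx y hy hxy.le) hn0 hn hs)
      rwa [hμ, restrict_Ioc_eq_restrict_Icc.symm]
    have e : (fun s => (sample hT.le F n).toFun s - γ s)
        = (F - γ) + ((sample hT.le F n).toFun - F) := by
      ext s; simp
    rw [e]
    exact (eLpNorm_add_le (hFc.aestronglyMeasurable.sub hγ.aestronglyMeasurable)
      ((measurable_toFun _).aestronglyMeasurable.sub hFc.aestronglyMeasurable)
      one_le_two).trans (add_le_add h1 h2)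
  choose g hg1 hg2 using key
  refine ⟨g, hg1, ?_⟩
  have h0 : Tendsto (fun k : ℕ => ENNReal.ofReal (1 / ((k : ℝ) + 1))) atTop (𝓝 0) := by
    simpa using ENNReal.tendsto_ofReal tendsto_one_div_add_atTop_nhds_zero_nat
  refine tendsto_of_tendsto_of_tendsto_of_le_of_le tendsto_const_nhds ?_ (fun k => zero_le)
    hg2
  have := h0.add (ENNReal.Tendsto.const_mul (a := μ Set.univ ^ (2 : ENNReal).toReal⁻¹) h0
    (Or.inr (by finiteness)))
  simpa using this

end StepFunction

/-! ### Smoothness of an integral in a scaling parameter -/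

section ParametricIntegral

variable {μ : Measure ℝ} {w γ : ℝ → ℝ} {C D : ℝ} {h : ℝ → ℂ}

/-- On a bounded range of parameters the integrand `w h(u γ)` has a constant bound. -/
lemma exists_bound_smul_comp (hw : ∀ᵐ s ∂μ, |w s| ≤ D) (hγ : ∀ᵐ s ∂μ, |γ s| ≤ C)
    (hh : Continuous h) (R : ℝ) :
    ∃ B : ℝ, ∀ᵐ s ∂μ, ∀ u ∈ Metric.ball (0 : ℝ) R, ‖w s • h (u * γ s)‖ ≤ B := by
  obtain ⟨B, hB⟩ := (isCompact_Icc (a := -(R * C)) (b := R * C)).exists_bound_of_continuousOn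
    hh.continuousOn
  refine ⟨D * B, ?_⟩
  filter_upwards [hw, hγ] with s hws hγs u hu
  rw [mem_ball_zero_iff, Real.norm_eq_abs] at hu
  have hm : u * γ s ∈ Set.Icc (-(R * C)) (R * C) := by
    rw [Set.mem_Icc, ← abs_le, abs_mul]
    exact mul_le_mul hu.le hγs (abs_nonneg _) ((abs_nonneg u).trans hu.le)
  rw [norm_smul, Real.norm_eq_abs]
  exact mul_le_mul hws (hB _ hm) (norm_nonneg _) ((abs_nonneg _).trans hws)

lemma aestronglyMeasurable_smul_comp (hwm : Measurable w) (hγm : Measurable γ)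
    (hh : Continuous h) (u : ℝ) : AEStronglyMeasurable (fun s => w s • h (u * γ s)) μ :=
  (hwm.smul (hh.measurable.comp (hγm.const_mul u))).aestronglyMeasurable

variable [IsFiniteMeasure μ]

lemma integrable_smul_comp (hwm : Measurable w) (hw : ∀ᵐ s ∂μ, |w s| ≤ D) (hγm : Measurable γ)
    (hγ : ∀ᵐ s ∂μ, |γ s| ≤ C) (hh : Continuous h) (u : ℝ) :
    Integrable (fun s => w s • h (u * γ s)) μ := by
  obtain ⟨B, hB⟩ := exists_bound_smul_comp hw hγ hh (|u| + 1)
  refine Integrable.of_bound (aestronglyMeasurable_smul_comp hwm hγm hh u) B ?_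
  filter_upwards [hB] with s hs
  exact hs u (by simp)

lemma continuous_integral_smul_comp (hwm : Measurable w) (hw : ∀ᵐ s ∂μ, |w s| ≤ D)
    (hγm : Measurable γ) (hγ : ∀ᵐ s ∂μ, |γ s| ≤ C) (hh : Continuous h) :
    Continuous fun u => ∫ s, w s • h (u * γ s) ∂μ := by
  refine continuous_iff_continuousAt.2 fun u => ?_
  obtain ⟨B, hB⟩ := exists_bound_smul_comp hw hγ hh (|u| + 1)
  refine continuousAt_of_dominated (bound := fun _ => B) (Eventually.of_forall fun v =>
    aestronglyMeasurable_smul_comp hwm hγm hh v) ?_ (integrable_const _)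
    (ae_of_all _ fun s => by fun_prop)
  filter_upwards [Metric.isOpen_ball.mem_nhds (show u ∈ Metric.ball (0 : ℝ) (|u| + 1) by simp)]
    with v hv
  filter_upwards [hB] with s hs using hs v hv

lemma hasDerivAt_integral_smul_comp (hwm : Measurable w) (hw : ∀ᵐ s ∂μ, |w s| ≤ D)
    (hγm : Measurable γ) (hγ : ∀ᵐ s ∂μ, |γ s| ≤ C) (hh : ContDiff ℝ 1 h) (u : ℝ) :
    HasDerivAt (fun u => ∫ s, w s • h (u * γ s) ∂μ)
      (∫ s, (w s * γ s) • deriv h (u * γ s) ∂μ) u := by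
  have hdc : Continuous (deriv h) := hh.continuous_deriv le_rfl
  have hwγ : ∀ᵐ s ∂μ, |w s * γ s| ≤ D * C := by
    filter_upwards [hw, hγ] with s h1 h2
    rw [abs_mul]
    exact mul_le_mul h1 h2 (abs_nonneg _) ((abs_nonneg _).trans h1)
  obtain ⟨B, hB⟩ := exists_bound_smul_comp hwγ hγ hdc (|u| + 1)
  refine (hasDerivAt_integral_of_dominated_loc_of_deriv_le (bound := fun _ => B)
    (F' := fun u s => (w s * γ s) • deriv h (u * γ s))
    (Metric.isOpen_ball.mem_nhds (show u ∈ Metric.ball (0 : ℝ) (|u| + 1) by simp))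
    (Eventually.of_forall fun v => aestronglyMeasurable_smul_comp hwm hγm hh.continuous v)
    (integrable_smul_comp hwm hw hγm hγ hh.continuous u)
    (aestronglyMeasurable_smul_comp (hwm.mul hγm) hγm hdc u) hB (integrable_const _)
    (ae_of_all _ fun s v _ => ?_)).2
  have h1 := ((hh.differentiable one_ne_zero (v * γ s)).hasDerivAt.scomp v
    (hasDerivAt_mul_const (γ s))).const_smul (w s)
  rwa [smul_smul] at h1

lemma contDiff_integral_smul_comp {n : ℕ} (hwm : Measurable w) (hw : ∀ᵐ s ∂μ, |w s| ≤ D)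
    (hγm : Measurable γ) (hγ : ∀ᵐ s ∂μ, |γ s| ≤ C) (hh : ContDiff ℝ n h) :
    ContDiff ℝ n fun u => ∫ s, w s • h (u * γ s) ∂μ := by
  induction n generalizing w D h with
  | zero =>
    simp only [Nat.cast_zero, contDiff_zero] at hh ⊢
    exact continuous_integral_smul_comp hwm hw hγm hγ hh
  | succ n ih =>
    push_cast at hh ⊢
    have hd := hasDerivAt_integral_smul_comp hwm hw hγm hγ (hh.of_le (by simp))
    refine contDiff_succ_iff_deriv.2 ⟨fun u => (hd u).differentiableAt, by simp, ?_⟩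
    rw [funext fun u => (hd u).deriv]
    refine ih (D := D * C) (hwm.mul hγm) ?_ (contDiff_succ_iff_deriv.1 hh).2.2
    filter_upwards [hw, hγ] with s h1 h2
    rw [abs_mul]
    exact mul_le_mul h1 h2 (abs_nonneg _) ((abs_nonneg _).trans h1)

end ParametricIntegral

/-! ### The Wiener integral -/

section WienerIntegral

variable {Ω : Type*} [MeasurableSpace Ω] {P : Measure Ω} {T : ℝ} {Λ : ℝ → Ω → ℝ}

/-- Step functions converging to the same `L²` limit have elementary integrals that are
asymptotically equal in `L²`. -/
lemma tendsto_eLpNorm_stepIntegral_sub [IsProbabilityMeasure P] (h : IsLevyProcess P T Λ)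
    (h2 : ∀ t ∈ Set.Icc 0 T, MemLp (Λ t) 2 P) (hT : 0 < T) {γ : ℝ → ℝ} (hγ : Measurable γ)
    {ι : Type*} {l : Filter ι} {g g' : ι → StepFunction T}
    (hg : Tendsto (fun k => eLpNorm (fun s => (g k).toFun s - γ s) 2
        (volume.restrict (Set.Icc 0 T))) l (𝓝 0))
    (hg' : Tendsto (fun k => eLpNorm (fun s => (g' k).toFun s - γ s) 2
        (volume.restrict (Set.Icc 0 T))) l (𝓝 0))
    {t : ℝ} (ht : t ∈ Set.Icc 0 T) :
    Tendsto (fun k => eLpNorm ((g k).integral Λ t - (g' k).integral Λ t) 2 P) l (𝓝 0) := by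
  set μ : Measure ℝ := volume.restrict (Set.Icc 0 T)
  set K := ENNReal.ofReal √(Var[Λ T; P] / T + (P[Λ T] / T) ^ 2 * T)
  have hlim := ENNReal.Tendsto.const_mul (a := K) (hg.add hg') (Or.inr ENNReal.ofReal_ne_top)
  rw [add_zero, mul_zero] at hlim
  refine tendsto_of_tendsto_of_tendsto_of_le_of_le tendsto_const_nhds hlim (fun _ => zero_le)
    fun k => (eLpNorm_stepIntegral_sub_le h h2 hT (g k) (g' k) ht).trans ?_
  refine mul_le_mul_right ?_ K
  have hm : ∀ f : StepFunction T, AEStronglyMeasurable (fun s => f.toFun s - γ s) μ := fun f =>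
    (f.measurable_toFun.sub hγ).aestronglyMeasurable
  have e : (g k).toFun - (g' k).toFun
      = (fun s => (g k).toFun s - γ s) - fun s => (g' k).toFun s - γ s := by
    ext s; simp
  rw [e]
  exact eLpNorm_sub_le (hm _) (hm _) one_le_two

/-- The Wiener integral of a bounded measurable function exists, by completeness of `L²(P)`. -/
lemma exists_wienerIntegral [IsProbabilityMeasure P] (h : IsLevyProcess P T Λ)
    (h2 : ∀ t ∈ Set.Icc 0 T, MemLp (Λ t) 2 P) (hT : 0 < T) {γ : ℝ → ℝ} (hγ : Measurable γ)
    {C : ℝ} (hC : ∀ s ∈ Set.Icc 0 T, |γ s| ≤ C) {t : ℝ} (ht : t ∈ Set.Icc 0 T) :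
    ∃ Y : Ω → ℝ, MemLp Y 2 P ∧ ∀ g : ℕ → StepFunction T,
      Tendsto (fun k => eLpNorm (fun s => (g k).toFun s - γ s) 2
        (volume.restrict (Set.Icc 0 T))) atTop (𝓝 0) →
      TendstoInMeasure P (fun k => (g k).integral Λ t) atTop Y := by
  obtain ⟨g, -, hg⟩ := StepFunction.exists_tendsto_eLpNorm hT hγ hC
  have M := fun f : StepFunction T => memLp_stepIntegral h2 f ht
  have hcau : CauchySeq fun k => (M (g k)).toLp ((g k).integral Λ t) := by
    rw [Lp.cauchySeq_Lp_iff_cauchySeq_eLpNorm]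
    have hg1 : Tendsto (fun p : ℕ × ℕ => p.1) atTop atTop := by
      rw [← prod_atTop_atTop_eq]; exact tendsto_fst
    have hg2 : Tendsto (fun p : ℕ × ℕ => p.2) atTop atTop := by
      rw [← prod_atTop_atTop_eq]; exact tendsto_snd
    refine (tendsto_eLpNorm_stepIntegral_sub h h2 hT hγ (hg.comp hg1) (hg.comp hg2) ht).congr
      fun p => eLpNorm_congr_ae ?_
    exact ((M _).coeFn_toLp.symm).sub (M _).coeFn_toLp.symm
  obtain ⟨Y, hY⟩ := cauchySeq_tendsto_of_complete hcau
  have hYlim : Tendsto (fun k => eLpNorm ((g k).integral Λ t - ⇑Y) 2 P) atTop (𝓝 0) := by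
    refine ((Lp.tendsto_Lp_iff_tendsto_eLpNorm' _ _).1 hY).congr fun k => eLpNorm_congr_ae ?_
    exact (M _).coeFn_toLp.sub EventuallyEq.rfl
  refine ⟨Y, Lp.memLp Y, fun g' hg' => ?_⟩
  refine tendstoInMeasure_of_tendsto_eLpNorm two_ne_zero (fun k => (M _).1) (Lp.memLp Y).1 ?_
  have hlim := (tendsto_eLpNorm_stepIntegral_sub h h2 hT hγ hg' hg ht).add hYlim
  rw [add_zero] at hlim
  refine tendsto_of_tendsto_of_tendsto_of_le_of_le tendsto_const_nhds hlim (fun _ => zero_le)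
    fun k => ?_
  have e : (g' k).integral Λ t - ⇑Y
      = ((g' k).integral Λ t - (g k).integral Λ t) + ((g k).integral Λ t - ⇑Y) := by abel
  dsimp only
  rw [e]
  exact eLpNorm_add_le ((M _).1.sub (M _).1) ((M _).1.sub (Lp.memLp Y).1) one_le_two

/-- The characteristic function of the Wiener integral: pass to the limit in the formula for
uniformly bounded step functions, along a subsequence on which both the integrands and the
integrals converge almost everywhere. -/
lemma charFun_wienerIntegral [IsProbabilityMeasure P] (h : IsLevyProcess P T Λ) (hT : 0 < T)
    {Ψ : ℝ → ℂ} (hΨ : IsLevyExponent P T Λ Ψ) (hΨ0 : Ψ 0 = 0) (hΨc : Continuous Ψ)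
    {γ : ℝ → ℝ} (hγ : Measurable γ) {C : ℝ} (hC : ∀ s ∈ Set.Icc 0 T, |γ s| ≤ C)
    {X : ℝ → Ω → ℝ} (hX : IsWienerIntegral P T Λ γ X) {t : ℝ} (ht : t ∈ Set.Icc 0 T) (u : ℝ) :
    charFun (P.map (X t)) u = Complex.exp (∫ s in (0 : ℝ)..t, Ψ (u * γ s)) := by
  obtain ⟨g, hgC, hg⟩ := StepFunction.exists_tendsto_eLpNorm hT hγ hC
  have hmeas : TendstoInMeasure (volume.restrict (Set.Icc 0 T)) (fun k => (g k).toFun) atTop γ :=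
    tendstoInMeasure_of_tendsto_eLpNorm two_ne_zero
      (fun k => (g k).measurable_toFun.aestronglyMeasurable) hγ.aestronglyMeasurable hg
  obtain ⟨a, ha, hae⟩ := hmeas.exists_seq_tendsto_ae
  obtain ⟨b, hb, hbe⟩ := ((hX t ht).2 (fun k => g (a k))
    (hg.comp ha.tendsto_atTop)).exists_seq_tendsto_ae
  have hI : ∀ f : StepFunction T, Measurable (f.integral Λ t) := fun f => by
    unfold StepFunction.integral
    exact Finset.measurable_sum _ fun i _ => ((h.measurable _ (f.min_node_mem ht _)).sub
      (h.measurable _ (f.min_node_mem ht _))).const_mul _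
  have hL : Tendsto (fun k => charFun (P.map ((g (a (b k))).integral Λ t)) u) atTop
      (𝓝 (charFun (P.map (X t)) u)) := by
    simp only [charFun_map_apply (hI _).aemeasurable, charFun_map_apply (hX t ht).1]
    refine tendsto_integral_of_dominated_convergence (fun _ => 1) (fun k => ?_)
      (integrable_const _) (fun k => ae_of_all _ fun ω => ?_) ?_
    · have := hI (g (a (b k)))
      exact Measurable.aestronglyMeasurable (by fun_prop)
    · rw [← Complex.ofReal_mul, Complex.norm_exp_ofReal_mul_I]
    · filter_upwards [hbe] with ω hω
      have hc : Continuous fun x : ℝ => Complex.exp (u * x * Complex.I) := by fun_prop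
      exact (hc.tendsto _).comp hω
  have hR : Tendsto (fun k => ∫ s in (0 : ℝ)..t, Ψ (u * (g (a (b k))).toFun s)) atTop
      (𝓝 (∫ s in (0 : ℝ)..t, Ψ (u * γ s))) := by
    obtain ⟨B, hB⟩ := (isCompact_Icc (a := -(|u| * C)) (b := |u| * C)).exists_bound_of_continuousOn
      hΨc.continuousOn
    refine intervalIntegral.tendsto_integral_filter_of_dominated_convergence (fun _ => B)
      (Eventually.of_forall fun k => ?_) (Eventually.of_forall fun k => ae_of_all _ fun s _ => ?_)
      intervalIntegrable_const ?_
    · exact (hΨc.measurable.comp ((g _).measurable_toFun.const_mul u)).aestronglyMeasurable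
    · refine hB _ ?_
      rw [Set.mem_Icc, ← abs_le, abs_mul]
      exact mul_le_mul_of_nonneg_left (hgC _ s) (abs_nonneg u)
    · filter_upwards [(ae_restrict_iff' measurableSet_Icc).1 hae] with s hs hst
      rw [Set.uIoc_of_le ht.1] at hst
      have hs' := hs ⟨hst.1.le, hst.2.trans ht.2⟩
      exact (hΨc.tendsto _).comp ((hs'.comp hb.tendsto_atTop).const_mul u)
  refine tendsto_nhds_unique hL ?_
  simp only [charFun_stepIntegral h hΨ hΨ0 _ ht]
  exact (Complex.continuous_exp.tendsto _).comp hR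

end WienerIntegral

theorem lemma3p14 {Ω : Type*} [MeasurableSpace Ω] (P : Measure Ω) [IsProbabilityMeasure P]
    (T : ℝ) (hT : 0 < T)
    (Λ : ℝ → Ω → ℝ) (hΛ : IsLevyProcess P T Λ)
    (hΛ2 : ∀ t ∈ Set.Icc 0 T, MemLp (Λ t) 2 P)
    (γ : ℝ → ℝ) (hγ : Measurable γ) (hγb : ∃ C : ℝ, ∀ s ∈ Set.Icc 0 T, |γ s| ≤ C) :
    -- the exponent of `Λ` and the process `∫_0^· γ dΛ` are well defined
    (∃! Ψ : ℝ → ℂ, IsLevyExponent P T Λ Ψ) ∧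
    (∃ X : ℝ → Ω → ℝ, IsWienerIntegral P T Λ γ X) ∧
    -- the formula and its consequences
    ∀ (Ψ : ℝ → ℂ) (X : ℝ → Ω → ℝ), IsLevyExponent P T Λ Ψ → IsWienerIntegral P T Λ γ X →
      ∀ t ∈ Set.Icc 0 T,
        (∀ u : ℝ, IntervalIntegrable (fun s => Ψ (u * γ s)) volume 0 t) ∧
        IsLogCharFun (P.map (X t)) (fun u => ∫ s in (0 : ℝ)..t, Ψ (u * γ s)) ∧
        ContDiff ℝ 2 (fun u : ℝ => ∫ s in (0 : ℝ)..t, Ψ (u * γ s)) ∧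
        MemLp (X t) 2 P := by
  obtain ⟨C, hC⟩ := hγb
  obtain ⟨Ψ₀, hΨ₀, hΨ₀2⟩ := hΛ.exists_exponent hΛ2 hT
  refine ⟨⟨Ψ₀, hΨ₀, fun Ψ hΨ => hΨ.unique hT hΨ₀⟩, ?_, ?_⟩
  · choose Y hY2 hY using fun t : Set.Icc (0 : ℝ) T =>
      exists_wienerIntegral hΛ hΛ2 hT hγ hC t.2
    classical
    refine ⟨fun t => if ht : t ∈ Set.Icc 0 T then Y ⟨t, ht⟩ else 0, fun t ht => ?_⟩
    simp only [dif_pos ht]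
    exact ⟨(hY2 _).1.aemeasurable, hY ⟨t, ht⟩⟩
  intro Ψ X hΨ hX t ht
  obtain rfl := hΨ.unique hT hΨ₀
  have hΨ0 : Ψ 0 = 0 := by
    have := (hΨ T ⟨hT.le, le_rfl⟩).2.1
    simpa [hT.ne'] using this
  have hγt : ∀ᵐ s ∂volume.restrict (Set.Ioc 0 t), |γ s| ≤ C :=
    (ae_restrict_iff' measurableSet_Ioc).2 (ae_of_all _ fun s hs =>
      hC s ⟨hs.1.le, hs.2.trans ht.2⟩)
  have hw : ∀ᵐ s ∂volume.restrict (Set.Ioc 0 t), |(fun _ : ℝ => (1 : ℝ)) s| ≤ 1 := by simp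
  have hcd : ContDiff ℝ 2 (fun u : ℝ => ∫ s in (0 : ℝ)..t, Ψ (u * γ s)) := by
    have := contDiff_integral_smul_comp (n := 2) measurable_const hw hγ hγt
      (by exact_mod_cast hΨ₀2)
    simpa only [intervalIntegral.integral_of_le ht.1, one_smul, Nat.cast_ofNat] using this
  refine ⟨fun u => ?_, ⟨hcd.continuous, by simp [hΨ0],
    charFun_wienerIntegral hΛ hT hΨ hΨ0 hΨ₀2.continuous hγ hC hX ht⟩, hcd, ?_⟩
  · rw [intervalIntegrable_iff_integrableOn_Ioc_of_le ht.1, IntegrableOn]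
    simpa only [one_smul] using
      integrable_smul_comp measurable_const hw hγ hγt hΨ₀2.continuous u
  · obtain ⟨Y, hY2, hY⟩ := exists_wienerIntegral hΛ hΛ2 hT hγ hC ht
    obtain ⟨g, -, hg⟩ := StepFunction.exists_tendsto_eLpNorm hT hγ hC
    exact hY2.ae_eq (tendstoInMeasure_ae_unique (hY g hg) ((hX t ht).2 g hg))
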